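/- Let $n\ge 0$ and let $\mathfrak{S}_n$ be the set of permutations $\sigma=\sigma_1\cdots\sigma_n$ of $\{1,\dots,n\}$. A permutation $\sigma\in\mathfrak{S}_n$ is called simsun if for all $k$ the subword of $\sigma$ formed by the letters in $\{1,\dots,k\}$ (in the order in which they appear in $\sigma$) has no three consecutive letters $a,b,c$ with $a>b>c$; it is called double simsun if both $\sigma$ and $\sigma^{-1}$ are simsun. For $\omega\in\mathfrak{S}_t$, $\sigma$ is $\omega$-avoiding if there are no indices $i_1<\cdots<i_t$ such that, for all $j,k$, $\sigma_{i_j}<\sigma_{i_k}$ if and only if $\omega_j<\omega_k$. Theorem. The number of double simsun permutations in $\mathfrak{S}_n$ that are both $132$-avoiding and $213$-avoiding is the Fibonacci number $F_{n+1}$, where $F_0=0$, $F_1=1$ and $F_{m+2}=F_{m+1}+F_m$ for $m\ge 0$. -/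

import Mathlib

/-- The one-line word `σ₁ σ₂ ⋯ σₙ` of a permutation, with letters in `{1, …, n}`. The elements
`0, …, n - 1` of `Fin n` stand for `1, …, n`. -/
def Equiv.Perm.word {n : ℕ} (σ : Equiv.Perm (Fin n)) : List ℕ :=
  List.ofFn fun i : Fin n => (σ i : ℕ) + 1

/-- The subword formed by the letters in `{1, …, k}`, in the order in which they appear in `w`. -/
def restrictWord (k : ℕ) (w : List ℕ) : List ℕ :=
  w.filter fun a => a ≤ k

/-- A word has a double descent if three consecutive letters `a, b, c` satisfy `a > b > c`. -/
def HasDoubleDescent (w : List ℕ) : Prop :=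
  ∃ a b c : ℕ, [a, b, c] <:+: w ∧ a > b ∧ b > c

/-- A permutation is simsun if for all `k` its subword restricted to `{1, …, k}` has no double
descents. -/
def IsSimsun {n : ℕ} (σ : Equiv.Perm (Fin n)) : Prop :=
  ∀ k : ℕ, ¬ HasDoubleDescent (restrictWord k σ.word)

/-- A permutation is double simsun if it and its inverse are both simsun. -/
def IsDoubleSimsun {n : ℕ} (σ : Equiv.Perm (Fin n)) : Prop :=
  IsSimsun σ ∧ IsSimsun σ⁻¹

/-- `σ` contains an `ω`-pattern if there are positions `i₁ < ⋯ < iₜ` at which the letters of `σ`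
are in the same relative order as the letters of `ω`. -/
def ContainsPattern {n t : ℕ} (σ : Equiv.Perm (Fin n)) (ω : Equiv.Perm (Fin t)) : Prop :=
  ∃ i : Fin t → Fin n, StrictMono i ∧ ∀ j k : Fin t, σ (i j) < σ (i k) ↔ ω j < ω k

/-- `σ` is `ω`-avoiding. -/
def AvoidsPattern {n t : ℕ} (σ : Equiv.Perm (Fin n)) (ω : Equiv.Perm (Fin t)) : Prop :=
  ¬ ContainsPattern σ ω

/-- The permutation `132`. -/
def perm132 : Equiv.Perm (Fin 3) := Equiv.swap 1 2

/-- The permutation `213`. -/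
def perm213 : Equiv.Perm (Fin 3) := Equiv.swap 0 1

theorem word_perm132 : perm132.word = [1, 3, 2] := by decide

theorem word_perm213 : perm213.word = [2, 1, 3] := by decide

/-- The set of double simsun permutations in `𝔖ₙ` that avoid both `132` and `213`. The pattern
condition is imposed on `σ` only, not on its inverse. -/
def DRS132213 (n : ℕ) : Set (Equiv.Perm (Fin n)) :=
  {σ | IsDoubleSimsun σ ∧ AvoidsPattern σ perm132 ∧ AvoidsPattern σ perm213}

/-! Avoiding 132 and 213 means that the word splits into increasing runs of consecutive values, each
run lying wholly below the preceding one. Such a permutation is determined by its descent set, which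
can be any subset of `range (n - 1)` (`IsReverseLayered.lt_iff`, `exists_isReverseLayered`). For
this class simsun just means no two adjacent descents, since restricting to small letters creates no
new double descent (`IsReverseLayered.isSimsun_iff`). The class is closed under inversion, and a
double descent of the inverse forces one of the permutation, so the inverse adds no condition. What
remains is to count sets without two consecutive elements, a Fibonacci recursion. -/

theorem card_sparse_powerset (m : ℕ) :
    ((Finset.range m).powerset.filter fun S => ∀ i ∈ S, i + 1 ∉ S).card = Nat.fib (m + 2) := by
  induction m using Nat.twoStepInduction with
  | zero => decide
  | one => decide
  | more m ih0 ih1 =>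
    rw [Nat.fib_add_two, ← ih0, ← ih1,
      Finset.range_add_one (n := m + 1), Finset.powerset_insert, Finset.filter_union,
      Finset.card_union_of_disjoint, add_comm]
    · congr 1
      -- A sparse set containing `m + 1` omits `m`, so the rest of it lies in `range m`.
      refine (Finset.card_bij (fun S _ => insert (m + 1) S) ?_ ?_ ?_).symm
      · intro S hS
        simp only [Finset.mem_filter, Finset.mem_powerset, Finset.mem_image] at hS ⊢
        refine ⟨⟨S, hS.1.trans (Finset.range_subset_range.2 (by lia)), rfl⟩, ?_⟩
        have hlt : ∀ x ∈ S, x < m := fun x hx => Finset.mem_range.1 (hS.1 hx)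
        grind
      · intro S hS T hT h
        simp only [Finset.mem_filter, Finset.mem_powerset] at hS hT
        have h1 : m + 1 ∉ S := fun hx => by have := Finset.mem_range.1 (hS.1 hx); lia
        have h2 : m + 1 ∉ T := fun hx => by have := Finset.mem_range.1 (hT.1 hx); lia
        rw [← Finset.erase_insert h1, h, Finset.erase_insert h2]
      · intro S hS
        simp only [Finset.mem_filter, Finset.mem_powerset, Finset.mem_image] at hS
        obtain ⟨⟨T, hT, rfl⟩, hsp⟩ := hS
        refine ⟨T, ?_, rfl⟩
        simp only [Finset.mem_filter, Finset.mem_powerset]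
        refine ⟨fun x hx => ?_, fun x hx hx' =>
          hsp x (Finset.mem_insert_of_mem hx) (Finset.mem_insert_of_mem hx')⟩
        have h1 := Finset.mem_range.1 (hT hx)
        have h2 := hsp x (Finset.mem_insert_of_mem hx)
        grind
    · rw [Finset.disjoint_left]
      intro S hS hS'
      simp only [Finset.mem_filter, Finset.mem_powerset, Finset.mem_image] at hS hS'
      obtain ⟨⟨T, -, rfl⟩, -⟩ := hS'
      have := Finset.mem_range.1 (hS.1 (Finset.mem_insert_self _ _))
      lia

theorem List.exists_split_of_infix_filter {α : Type*} {p : α → Bool} {L : List α} {a b c : α}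
    (h : [a, b, c] <:+: L.filter p) :
    p a ∧ p b ∧ p c ∧ ∃ L₀ L₁ L₂ L₃ : List α, L = L₀ ++ a :: (L₁ ++ b :: (L₂ ++ c :: L₃)) ∧
      (∀ x ∈ L₁, ¬ p x) ∧ ∀ x ∈ L₂, ¬ p x := by
  obtain ⟨s, t, h⟩ := h
  rw [List.append_assoc, eq_comm, List.filter_eq_append_iff] at h
  obtain ⟨M, N, rfl, -, h⟩ := h
  simp only [List.cons_append, List.nil_append, List.filter_eq_cons_iff] at h
  obtain ⟨A, B, rfl, -, ha, C, D, rfl, hC, hb, E, F, rfl, hE, hc, -⟩ := h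
  exact ⟨ha, hb, hc, M ++ A, C, E, F, by simp, hC, hE⟩

/-! ### Pattern avoidance and reverse layered permutations -/

/-- Two letters in increasing order enclose only letters of intermediate value. -/
def IsReverseLayered {n : ℕ} (σ : Equiv.Perm (Fin n)) : Prop :=
  ∀ i j k : Fin n, i < j → j < k → σ i < σ k → σ i < σ j ∧ σ j < σ k

theorem containsPattern_three_iff {n : ℕ} (σ : Equiv.Perm (Fin n)) (ω : Equiv.Perm (Fin 3)) :
    ContainsPattern σ ω ↔ ∃ f : Fin 3 → Fin n, f 0 < f 1 ∧ f 1 < f 2 ∧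
      ∀ j k : Fin 3, σ (f j) < σ (f k) ↔ ω j < ω k := by
  refine exists_congr fun f => ?_
  rw [← and_assoc]
  refine and_congr_left fun _ => ?_
  rw [Fin.strictMono_iff_lt_succ]
  simp [Fin.forall_fin_two]

theorem avoids_iff_isReverseLayered {n : ℕ} (σ : Equiv.Perm (Fin n)) :
    AvoidsPattern σ perm132 ∧ AvoidsPattern σ perm213 ↔ IsReverseLayered σ := by
  have e1 : perm132 0 = 0 ∧ perm132 1 = 2 ∧ perm132 2 = 1 := by decide
  have e2 : perm213 0 = 1 ∧ perm213 1 = 0 ∧ perm213 2 = 2 := by decide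
  simp only [AvoidsPattern, containsPattern_three_iff]
  constructor
  · rintro ⟨h1, h2⟩ i j k hij hjk hik
    have n1 : σ i ≠ σ j := fun h => hij.ne (σ.injective h)
    have n2 : σ j ≠ σ k := fun h => hjk.ne (σ.injective h)
    by_contra hcon
    by_cases hlt : σ i < σ j
    · refine h1 ⟨![i, j, k], hij, hjk, ?_⟩
      simp only [Fin.forall_fin_succ, Matrix.cons_val]
      simp [e1]
      grind
    · refine h2 ⟨![i, j, k], hij, hjk, ?_⟩
      simp only [Fin.forall_fin_succ, Matrix.cons_val]
      simp [e2]
      grind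
  · intro h
    refine ⟨?_, ?_⟩
    · rintro ⟨f, h01, h12, hf⟩
      have a := (hf 0 2).2 (by decide)
      have b := (hf 2 1).2 (by decide)
      exact lt_asymm b (h _ _ _ h01 h12 a).2
    · rintro ⟨f, h01, h12, hf⟩
      have a := (hf 0 2).2 (by decide)
      have b := (hf 1 0).2 (by decide)
      exact lt_asymm b (h _ _ _ h01 h12 a).1

/-! ### Double descents, in the subwords and in the inverse -/

/-- `HasDoubleFall σ` says that the word of `σ` has three consecutive decreasing letters. -/
def HasDoubleFall {n : ℕ} (σ : Equiv.Perm (Fin n)) : Prop :=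
  ∃ i j k : Fin n, (i : ℕ) + 1 = j ∧ (j : ℕ) + 1 = k ∧ σ k < σ j ∧ σ j < σ i

theorem word_eq_map {n : ℕ} (σ : Equiv.Perm (Fin n)) :
    σ.word = (List.finRange n).map fun i => (σ i : ℕ) + 1 :=
  List.ofFn_eq_map

theorem hasDoubleDescent_of_hasDoubleFall {n : ℕ} {σ : Equiv.Perm (Fin n)}
    (h : HasDoubleFall σ) : HasDoubleDescent (restrictWord n σ.word) := by
  obtain ⟨i, j, k, hij, hjk, h1, h2⟩ := h
  have hw : restrictWord n σ.word = σ.word := by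
    refine List.filter_eq_self.2 fun a ha => ?_
    rw [word_eq_map, List.mem_map] at ha
    obtain ⟨x, -, rfl⟩ := ha
    simp
  rw [hw]
  refine ⟨σ i + 1, σ j + 1, σ k + 1, ?_, by simpa using h2, by simpa using h1⟩
  rw [List.infix_iff_getElem?]
  refine ⟨i, by simp [Equiv.Perm.word]; lia, fun m hm => ?_⟩
  have hj : j = ⟨1 + i, by lia⟩ := Fin.ext (by simp; lia)
  have hk : k = ⟨2 + i, by lia⟩ := Fin.ext (by simp; lia)
  simp only [List.length_cons, List.length_nil] at hm
  interval_cases m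
  · simp [Equiv.Perm.word]
  · simp [Equiv.Perm.word, List.getElem?_ofFn, hj]; lia
  · simp [Equiv.Perm.word, List.getElem?_ofFn, hk]; lia

/-- Letters erased between consecutive kept ones exceed `K`, hence also the kept letter at `i`. -/
theorem exists_positions_of_hasDoubleDescent {n K : ℕ} {σ : Equiv.Perm (Fin n)}
    (h : HasDoubleDescent (restrictWord K σ.word)) :
    ∃ i j k : Fin n, i < j ∧ j < k ∧ σ k < σ j ∧ σ j < σ i ∧
      (∀ l, i < l → l < j → σ i < σ l) ∧ ∀ l, j < l → l < k → σ i < σ l := by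
  obtain ⟨a, b, c, h, hab, hbc⟩ := h
  rw [restrictWord, word_eq_map, List.filter_map] at h
  obtain ⟨s, t, h⟩ := h
  rw [List.append_assoc, List.append_eq_map_iff] at h
  obtain ⟨s', u, hu, -, h⟩ := h
  simp only [List.cons_append, List.nil_append, List.map_eq_cons_iff] at h
  obtain ⟨i, -, rfl, rfl, j, -, rfl, rfl, k, t', rfl, rfl, -⟩ := h
  obtain ⟨hi, -, -, L₀, L₁, L₂, L₃, hL, h₁, h₂⟩ :=
    List.exists_split_of_infix_filter (a := i) (b := j) (c := k) ⟨s', t', by rw [hu]; simp⟩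
  have hp := List.pairwise_lt_finRange n
  have hm : ∀ l : Fin n, l ∈ List.finRange n := List.mem_finRange
  rw [hL] at hp hm
  simp only [List.pairwise_append, List.pairwise_cons, List.mem_append, List.mem_cons] at hp hm
  simp only [Function.comp_apply, decide_eq_true_eq] at hi h₁ h₂
  refine ⟨i, j, k, by grind, by grind, by lia, by lia, fun l hl hl' => ?_, fun l hl hl' => ?_⟩
  · have : l ∈ L₁ := by grind
    have := h₁ l this
    lia
  · have : l ∈ L₂ := by grind
    have := h₂ l this
    lia

/-- Both patterns are involutions, so positions and values play symmetric roles. -/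
theorem IsReverseLayered.inv {n : ℕ} {σ : Equiv.Perm (Fin n)} (h : IsReverseLayered σ) :
    IsReverseLayered σ⁻¹ := by
  intro a b c hab hbc hac
  obtain ⟨i, rfl⟩ := σ.surjective a
  obtain ⟨j, rfl⟩ := σ.surjective b
  obtain ⟨k, rfl⟩ := σ.surjective c
  simp only [Equiv.Perm.inv_def, Equiv.symm_apply_apply] at hac ⊢
  have h1 := h i k j
  have h2 := h j i k
  have n1 : i ≠ j := by rintro rfl; exact lt_irrefl _ hab
  have n2 : j ≠ k := by rintro rfl; exact lt_irrefl _ hbc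
  grind

/-- The fall is at `j` and its two neighbours: each neighbour is `i` or `k`, or lies strictly
between and is controlled by `h₁` or `h₂`. -/
theorem hasDoubleFall_of_positions {n : ℕ} {σ : Equiv.Perm (Fin n)} {i j k : Fin n} (hij : i < j) (hjk : j < k) (hkj : σ k < σ j)
    (hji : σ j < σ i) (h₁ : ∀ l, i < l → l < j → σ j < σ l)
    (h₂ : ∀ l, j < l → l < k → σ l < σ j) : HasDoubleFall σ := by
  have hj := j.isLt
  have hk := k.isLt
  refine ⟨⟨j - 1, by lia⟩, j, ⟨j + 1, by lia⟩, by simp; lia, by simp, ?_, ?_⟩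
  · rcases (show (j : ℕ) + 1 = k ∨ (j : ℕ) + 1 < k by lia) with e | e
    · convert hkj
    · exact h₂ _ (by simp [Fin.lt_def]) (by simpa [Fin.lt_def] using e)
  · rcases (show (i : ℕ) = j - 1 ∨ (i : ℕ) < j - 1 by lia) with e | e
    · convert hji; exact e.symm
    · exact h₁ _ (by simpa [Fin.lt_def] using e) (by simp [Fin.lt_def]; lia)

theorem IsReverseLayered.isSimsun_iff {n : ℕ} {σ : Equiv.Perm (Fin n)} (h : IsReverseLayered σ) :
    IsSimsun σ ↔ ¬ HasDoubleFall σ := by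
  refine ⟨fun hs hf => hs n (hasDoubleDescent_of_hasDoubleFall hf), fun hf K hd => hf ?_⟩
  obtain ⟨i, j, k, hij, hjk, h1, h2, h3, h4⟩ := exists_positions_of_hasDoubleDescent hd
  refine hasDoubleFall_of_positions hij hjk h1 h2 (fun l a b => h2.trans (h3 l a b))
    fun l a b => ?_
  have c := h4 l a b
  -- No letter was erased between `j` and `k`: one above `σ i` would force `σ i < σ j`.
  exact absurd (h i j l hij a c).1 h2.asymm

theorem IsReverseLayered.hasDoubleFall_of_inv {n : ℕ} {σ : Equiv.Perm (Fin n)}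
    (h : IsReverseLayered σ) (hf : HasDoubleFall σ⁻¹) : HasDoubleFall σ := by
  obtain ⟨a, b, c, hab, hbc, h1, h2⟩ := hf
  obtain ⟨i, rfl⟩ := σ.surjective a
  obtain ⟨j, rfl⟩ := σ.surjective b
  obtain ⟨k, rfl⟩ := σ.surjective c
  simp only [Equiv.Perm.inv_def, Equiv.symm_apply_apply] at h1 h2
  -- The consecutive values `σ i`, `σ j`, `σ k` stand at positions `k < j < i`. A letter violating a
  -- bound would lie below `σ i` or above `σ k`, against the layering.
  refine hasDoubleFall_of_positions h1 h2 (by lia) (by lia) (fun l a b => ?_) fun l a b => ?_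
  · by_contra hc
    have n1 : σ l ≠ σ j := fun e => b.ne (σ.injective e)
    have n2 : σ l ≠ σ i := fun e => (b.trans h2).ne (σ.injective e)
    have := h l j i b h2 (by lia)
    lia
  · by_contra hc
    have n1 : σ l ≠ σ j := fun e => a.ne' (σ.injective e)
    have n2 : σ l ≠ σ k := fun e => (h1.trans a).ne' (σ.injective e)
    have := h k j l h1 a (by lia)
    lia

/-! ### Descent sets determine reverse layered permutations -/

/-- The positions, counted from `0`, of the letters of `σ` followed by a smaller letter. -/
def descents {n : ℕ} (σ : Equiv.Perm (Fin n)) : Finset ℕ :=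
  (Finset.range (n - 1)).filter fun d => ∃ i j : Fin n, (i : ℕ) = d ∧ (j : ℕ) = d + 1 ∧ σ j < σ i

theorem mem_descents {n : ℕ} {σ : Equiv.Perm (Fin n)} {i j : Fin n} (h : (i : ℕ) + 1 = j) :
    (i : ℕ) ∈ descents σ ↔ σ j < σ i := by
  simp only [descents, Finset.mem_filter, Finset.mem_range]
  constructor
  · rintro ⟨-, i', j', hi, hj, hlt⟩
    obtain rfl : i' = i := Fin.ext hi
    obtain rfl : j' = j := Fin.ext (by lia)
    exact hlt
  · exact fun hlt => ⟨by lia, i, j, rfl, h.symm, hlt⟩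

theorem not_hasDoubleFall_iff {n : ℕ} (σ : Equiv.Perm (Fin n)) :
    ¬ HasDoubleFall σ ↔ ∀ d ∈ descents σ, d + 1 ∉ descents σ := by
  constructor
  · intro h d hd hd'
    have hd1 := Finset.mem_range.1 (Finset.mem_filter.1 hd').1
    refine h ⟨⟨d, by lia⟩, ⟨d + 1, by lia⟩, ⟨d + 2, by lia⟩, rfl, rfl, ?_, ?_⟩
    · exact (mem_descents rfl).1 hd'
    · exact (mem_descents rfl).1 hd
  · rintro h ⟨i, j, k, hij, hjk, h1, h2⟩
    refine h i ((mem_descents hij).2 h2) ?_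
    rw [hij]
    exact (mem_descents hjk).2 h1

/-- The right side says that no descent separates `i` from `j`: they share an increasing run. -/
theorem IsReverseLayered.lt_iff {n : ℕ} {σ : Equiv.Perm (Fin n)} (h : IsReverseLayered σ)
    {i j : Fin n} (hij : i < j) :
    σ i < σ j ↔ ∀ d ∈ descents σ, (i : ℕ) ≤ d → (j : ℕ) ≤ d := by
  constructor
  · intro hlt d hd hid
    by_contra hjd
    have hj := j.isLt
    have hfall : σ ⟨d + 1, by lia⟩ < σ ⟨d, by lia⟩ := (mem_descents rfl).1 hd
    have key : ∀ l, i ≤ l → l < j → σ i ≤ σ l := fun l h1 h2 =>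
      h1.eq_or_lt.elim (fun e => (congrArg σ e).le) fun h1 => (h i l j h1 h2 hlt).1.le
    rcases (show d + 1 = j ∨ d + 1 < j by lia) with e | e
    · have e' : j = ⟨d + 1, by lia⟩ := Fin.ext e.symm
      have := key ⟨d, by lia⟩ hid (by simp [Fin.lt_def]; lia)
      rw [← e'] at hfall
      rcases (show (i : ℕ) = d ∨ (i : ℕ) < d by lia) with f | f
      · have f' : i = ⟨d, by lia⟩ := Fin.ext f
        rw [← f'] at hfall
        exact hfall.asymm hlt
      · exact hfall.asymm (h i ⟨d, by lia⟩ j f (by simp [Fin.lt_def]; lia) hlt).2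
    · have hlt' := (h i ⟨d + 1, by lia⟩ j (by simp [Fin.lt_def]; lia) e hlt).1
      rcases (show (i : ℕ) = d ∨ (i : ℕ) < d by lia) with f | f
      · have f' : i = ⟨d, by lia⟩ := Fin.ext f
        rw [← f'] at hfall
        exact hfall.asymm hlt'
      · exact hfall.asymm (h i ⟨d, by lia⟩ ⟨d + 1, by lia⟩ f (by simp [Fin.lt_def]) hlt').2
  · intro hd
    have key : ∀ m : ℕ, ∀ hm : m < n, (i : ℕ) < m → m ≤ j → σ i < σ ⟨m, hm⟩ := by
      intro m
      induction m with
      | zero => intro _ h0; lia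
      | succ m ih =>
        intro hm him hmj
        have hm' : m < n := by lia
        have hstep : σ ⟨m, hm'⟩ < σ ⟨m + 1, hm⟩ := by
          have hn : m ∉ descents σ := fun hmem => by have := hd m hmem (by lia); lia
          have hle := not_lt.1 (mt (mem_descents (σ := σ) (i := ⟨m, hm'⟩) (j := ⟨m + 1, hm⟩) rfl).2 hn)
          exact lt_of_le_of_ne hle fun e => by simpa using σ.injective e
        rcases (show (i : ℕ) = m ∨ (i : ℕ) < m by lia) with f | f
        · have f' : i = ⟨m, by lia⟩ := Fin.ext f
          rwa [← f'] at hstep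
        · exact (ih hm' f (by lia)).trans hstep
    exact key j j.isLt hij le_rfl

theorem perm_eq_of_lt_iff {n : ℕ} {σ τ : Equiv.Perm (Fin n)}
    (h : ∀ i j, i < j → (σ i < σ j ↔ τ i < τ j)) : σ = τ := by
  -- The only increasing permutation of `Fin n` is the identity.
  have hmono : StrictMono (τ * σ⁻¹) := by
    intro a b hab
    obtain ⟨i, rfl⟩ := σ.surjective a
    obtain ⟨j, rfl⟩ := σ.surjective b
    simp only [Equiv.Perm.mul_apply, Equiv.Perm.inv_def, Equiv.symm_apply_apply]
    rcases lt_trichotomy i j with hij | rfl | hij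
    · exact (h i j hij).1 hab
    · exact absurd hab (lt_irrefl _)
    · refine lt_of_le_of_ne (not_lt.1 (mt (h j i hij).2 hab.asymm)) fun e => ?_
      exact hij.ne' (τ.injective e)
  have := (Equiv.Perm.monotone_iff _).1 hmono.monotone
  exact (mul_inv_eq_one.1 this).symm

theorem IsReverseLayered.eq_of_descents_eq {n : ℕ} {σ τ : Equiv.Perm (Fin n)}
    (hσ : IsReverseLayered σ) (hτ : IsReverseLayered τ) (h : descents σ = descents τ) : σ = τ :=
  perm_eq_of_lt_iff fun i j hij => by rw [hσ.lt_iff hij, hτ.lt_iff hij, h]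

theorem exists_perm_lt_iff {n : ℕ} {α : Type*} [LinearOrder α] {f : Fin n → α}
    (hf : Function.Injective f) : ∃ σ : Equiv.Perm (Fin n), ∀ i j, σ i < σ j ↔ f i < f j := by
  refine ⟨(Tuple.sort f)⁻¹, fun i j => ?_⟩
  have hmono : StrictMono (f ∘ Tuple.sort f) :=
    (Tuple.monotone_sort f).strictMono_of_injective (hf.comp (Tuple.sort f).injective)
  rw [← hmono.lt_iff_lt]
  simp

theorem exists_isReverseLayered {n : ℕ} {S : Finset ℕ} (hS : S ⊆ Finset.range (n - 1)) :
    ∃ σ : Equiv.Perm (Fin n), IsReverseLayered σ ∧ descents σ = S := by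
  let c : Fin n → Finset ℕ := fun i => S.filter (· < (i : ℕ))
  -- Cutting after each element of `S`, later runs come lower, hence the sign; within a run,
  -- position decides.
  let f : Fin n → ℤ ×ₗ Fin n := fun i => toLex (-((c i).card : ℤ), i)
  have hf : Function.Injective f := fun i j h => (Prod.mk.inj (toLex.injective h)).2
  obtain ⟨σ, hσ⟩ := exists_perm_lt_iff hf
  have key : ∀ i j, i < j → (σ i < σ j ↔ ∀ d ∈ S, (i : ℕ) ≤ d → (j : ℕ) ≤ d) := by
    intro i j hij
    have hsub : c i ⊆ c j := fun d hd => by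
      simp only [c, Finset.mem_filter] at hd ⊢
      exact ⟨hd.1, by lia⟩
    have hle := Finset.card_le_card hsub
    rw [hσ, Prod.Lex.toLex_lt_toLex]
    simp only [hij, and_true, neg_lt_neg_iff, neg_inj, Nat.cast_lt, Nat.cast_inj]
    constructor
    · intro h d hd hid
      by_contra hdj
      have hcc := Finset.eq_of_subset_of_card_le hsub (by lia)
      have : d ∈ c i := hcc ▸ Finset.mem_filter.2 ⟨hd, by lia⟩
      have := (Finset.mem_filter.1 this).2
      lia
    · intro h
      refine Or.inr (congrArg Finset.card (hsub.antisymm fun d hd => ?_))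
      simp only [c, Finset.mem_filter] at hd ⊢
      refine ⟨hd.1, ?_⟩
      by_contra hcon
      have := h d hd.1 (by lia)
      lia
  refine ⟨σ, ?_, ?_⟩
  · intro i j k hij hjk hik
    rw [key i k (hij.trans hjk)] at hik
    rw [key i j hij, key j k hjk]
    exact ⟨fun d hd h => by have := hik d hd h; lia, fun d hd h => hik d hd (by lia)⟩
  · have hmem : ∀ i j : Fin n, (i : ℕ) + 1 = j → ((i : ℕ) ∈ descents σ ↔ (i : ℕ) ∈ S) := by
      intro i j hij
      have hlt : i < j := by lia
      have hne : σ i ≠ σ j := fun e => hlt.ne (σ.injective e)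
      rw [mem_descents hij, ← not_iff_not, not_lt, le_iff_lt_or_eq, or_iff_left hne, key i j hlt]
      constructor
      · intro h hi
        have := h i hi le_rfl
        lia
      · intro h d hd hid
        rcases hid.eq_or_lt with rfl | hid
        · exact absurd hd h
        · lia
    ext d
    by_cases hd : d < n - 1
    · exact hmem ⟨d, by lia⟩ ⟨d + 1, by lia⟩ rfl
    · exact ⟨fun h => absurd (Finset.mem_range.1 (Finset.mem_filter.1 h).1) hd,
        fun h => absurd (Finset.mem_range.1 (hS h)) hd⟩

/-! ### The count -/

theorem mem_DRS132213_iff {n : ℕ} (σ : Equiv.Perm (Fin n)) :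
    σ ∈ DRS132213 n ↔ IsReverseLayered σ ∧ ∀ d ∈ descents σ, d + 1 ∉ descents σ := by
  rw [DRS132213, Set.mem_ofPred_eq, avoids_iff_isReverseLayered, and_comm]
  refine and_congr_right fun h => ?_
  rw [← not_hasDoubleFall_iff, IsDoubleSimsun, h.isSimsun_iff, h.inv.isSimsun_iff]
  exact ⟨And.left, fun hf => ⟨hf, mt h.hasDoubleFall_of_inv hf⟩⟩

theorem mainTheorem6 (n : ℕ) : (DRS132213 n).ncard = Nat.fib (n + 1) := by
  have hcard : (DRS132213 n).ncard =
      ((Finset.range (n - 1)).powerset.filter fun S => ∀ i ∈ S, i + 1 ∉ S).card := by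
    rw [← Set.ncard_coe_finset]
    refine Set.ncard_congr (fun σ _ => descents σ) (fun σ hσ => ?_) (fun σ τ hσ hτ h => ?_)
      fun S hS => ?_
    · rw [mem_DRS132213_iff] at hσ
      simpa using ⟨Finset.filter_subset _ _, hσ.2⟩
    · rw [mem_DRS132213_iff] at hσ hτ
      exact hσ.1.eq_of_descents_eq hτ.1 h
    · simp only [Finset.coe_filter, Finset.mem_powerset, Set.mem_ofPred_eq] at hS
      obtain ⟨σ, hσ, rfl⟩ := exists_isReverseLayered hS.1
      exact ⟨σ, (mem_DRS132213_iff σ).2 ⟨hσ, hS.2⟩, rfl⟩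
  rw [hcard, card_sparse_powerset]
  -- For `n = 0` the truncated `n - 1` is `0`, and `fib 2 = fib 1`.
  cases n with
  | zero => rfl
  | succ n => rfl
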